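/- All groups are abelian. A subgroup $A$ of a group $B$ is \emph{pure} if $nA = A\cap nB$ for every integer $n$. A group $N$ is \emph{pure-split} if every pure subgroup of $N$ is a direct summand of $N$, and a group $K$ is \emph{$N$-pure-injective} if for every pure subgroup $L$ of $N$ every homomorphism $L\to K$ extends to a homomorphism $N\to K$. A group is \emph{uniform} if it is nonzero and any two of its nonzero subgroups intersect nontrivially. A group is \emph{reduced} if $0$ is its only divisible subgroup. A torsion-free group is \emph{completely decomposable} if it is a direct sum of groups each isomorphic to a nonzero subgroup of $\mathbb{Q}$. For an element $a$ of a torsion-free group and a prime $p$, the $p$-height $h_p(a)\in\{0,1,2,\dots,\infty\}$ is the largest $k$ such that $p^k$ divides $a$ (and $\infty$ if there is no largest one). Two nonzero elements $a,b$ have the same \emph{type} if $h_p(a)\neq h_p(b)$ for only finitely many primes $p$, and both heights are finite for each such $p$; a torsion-free group is \emph{homogeneous} if all its nonzero elements have the same type. Let $\{A_\gamma\mid\gamma\in\Gamma\}$ be a complete set of representatives of the isomorphism classes of uniform groups, and let $$M=\bigoplus_{\gamma\in\Gamma}A_\gamma^{(\mathbb{N})},$$ where $A_\gamma^{(\mathbb{N})}$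 is the direct sum of countably infinitely many copies of $A_\gamma$. Let $N$ be a torsion-free reduced group. Then the following are equivalent. (1) $M$ is $N$-pure-injective. (2) $N$ is pure-split. (3) $N$ is a completely decomposable homogeneous group of finite rank. -/

import Mathlib

universe u v w

/-- A subgroup `A` of an abelian group `B` is pure if `nA = A ∩ nB` for every integer `n`. -/
def IsPureSubgroup {B : Type*} [AddCommGroup B] (A : AddSubgroup B) : Prop :=
  ∀ n : ℤ, A.map (zsmulAddGroupHom n) = A ⊓ (zsmulAddGroupHom n : B →+ B).range

/-- `N` is pure-split if every pure subgroup of `N` is a direct summand. -/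
def IsPureSplit (N : Type*) [AddCommGroup N] : Prop :=
  ∀ L : AddSubgroup N, IsPureSubgroup L → ∃ C : AddSubgroup N, IsCompl L C

/-- `K` is `N`-pure-injective if every homomorphism `L → K` from a pure subgroup `L` of `N`
extends to a homomorphism `N → K`. -/
def IsPureInjectiveRel (K : Type*) [AddCommGroup K] (N : Type*) [AddCommGroup N] : Prop :=
  ∀ L : AddSubgroup N, IsPureSubgroup L →
    ∀ f : L →+ K, ∃ g : N →+ K, ∀ x : L, g x = f x

/-- A uniform group: nonzero, and any two nonzero subgroups have nonzero intersection. -/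
def IsUniformAbelianGroup (A : Type*) [AddCommGroup A] : Prop :=
  Nontrivial A ∧ ∀ H K : AddSubgroup A, H ≠ ⊥ → K ≠ ⊥ → H ⊓ K ≠ ⊥

/-- `A` is a complete set of representatives of the isomorphism classes of uniform groups: every
`A γ` is uniform, distinct members are not isomorphic, and every uniform group is isomorphic to
some `A γ`. (Uniform groups are countable, so restricting the last clause to the universe `w` loses
no isomorphism class.) -/
structure IsCompleteUniformFamily {Γ : Type v} (A : Γ → Type w)
    [∀ γ, AddCommGroup (A γ)] : Prop where
  uniform : ∀ γ, IsUniformAbelianGroup (A γ)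
  eq_of_iso : ∀ γ δ, Nonempty (A γ ≃+ A δ) → γ = δ
  exists_iso : ∀ (B : Type w) [AddCommGroup B], IsUniformAbelianGroup B → ∃ γ, Nonempty (B ≃+ A γ)

/-- The direct sum `⨁ γ, A γ ^ (ℕ)`. -/
abbrev CountableMultiplesSum {Γ : Type v} (A : Γ → Type w)
    [∀ γ, AddCommGroup (A γ)] : Type (max v w) :=
  DirectSum Γ (fun γ => ℕ →₀ A γ)

/-- A divisible group: `nD = D` for every positive integer `n`. -/
def IsDivisibleGroup (D : Type*) [AddCommGroup D] : Prop :=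
  ∀ n : ℕ, 0 < n → ∀ x : D, ∃ y : D, n • y = x

/-- A reduced group: the only divisible subgroup is `0`. -/
def IsReducedGroup (N : Type*) [AddCommGroup N] : Prop :=
  ∀ D : AddSubgroup N, IsDivisibleGroup D → D = ⊥

/-- `N` is completely decomposable: it is the direct sum of a family of subgroups each of which
is isomorphic to a nonzero subgroup of `ℚ`. -/
def IsCompletelyDecomposable (N : Type u) [AddCommGroup N] : Prop :=
  ∃ (ι : Type u) (_ : DecidableEq ι) (K : ι → AddSubgroup N), DirectSum.IsInternal K ∧
    ∀ i, ∃ H : AddSubgroup ℚ, H ≠ ⊥ ∧ Nonempty (K i ≃+ H)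

/-- The `p`-height of `a`: the largest `k` such that `p ^ k` divides `a`, or `∞`. -/
noncomputable def pHeight {N : Type*} [AddCommGroup N] (p : ℕ) (a : N) : ℕ∞ :=
  ⨆ (k : ℕ) (_ : ∃ b : N, p ^ k • b = a), (k : ℕ∞)

/-- The characteristic of `a`: the family of its `p`-heights, `p` running over the primes. -/
noncomputable def heightCharacteristic {N : Type*} [AddCommGroup N] (a : N) :
    Nat.Primes → ℕ∞ :=
  fun p => pHeight (p : ℕ) a

/-- Two characteristics are equivalent if they differ at finitely many primes only, and both are
finite wherever they differ. -/
def CharacteristicEquiv (c d : Nat.Primes → ℕ∞) : Prop :=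
  {p | c p ≠ d p}.Finite ∧ ∀ p, c p ≠ d p → c p ≠ ⊤ ∧ d p ≠ ⊤

/-- Equivalence of characteristics as a setoid; its classes are the types. -/
def characteristicSetoid : Setoid (Nat.Primes → ℕ∞) where
  r := CharacteristicEquiv
  iseqv :=
    { refl := fun c => ⟨by simp, fun p h => absurd rfl h⟩
      symm := fun {c d} h =>
        ⟨by simpa only [ne_comm] using h.1, fun p hp => (h.2 p hp.symm).symm⟩
      trans := fun {c d e} h k =>
        ⟨(h.1.union k.1).subset fun p hp => by
            by_contra hn
            simp only [Set.mem_union, Set.mem_ofPred_eq, not_or, not_not] at hn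
            exact hp (hn.1.trans hn.2),
          fun p hp => by
            by_cases h1 : c p = d p
            · have h2 : d p ≠ e p := fun h2 => hp (h1.trans h2)
              exact ⟨h1 ▸ (k.2 p h2).1, (k.2 p h2).2⟩
            · by_cases h2 : d p = e p
              · exact ⟨(h.2 p h1).1, h2 ▸ (h.2 p h1).2⟩
              · exact ⟨(h.2 p h1).1, (k.2 p h2).2⟩⟩ }

/-- The type of an element: the class of its characteristic. -/
noncomputable def elementType {N : Type*} [AddCommGroup N] (a : N) :
    Quotient characteristicSetoid :=
  Quotient.mk characteristicSetoid (heightCharacteristic a)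

/-- A homogeneous group: all nonzero elements have the same type. -/
def IsHomogeneousGroup (N : Type*) [AddCommGroup N] : Prop :=
  ∀ a b : N, a ≠ 0 → b ≠ 0 → elementType a = elementType b

/-! (1) ⇒ (3): a nonzero `pureSpan c` has rank one, hence is uniform and a retract of `M`. Extending
its inclusion into `M` to `N` and retracting shows that it is a summand of `N`. A Gram–Schmidt
process with these projections writes the pure closure of any sequence as a direct sum of pure spans
(`exists_pureClosure_eq_directSum`). Since `M` has countably many copies of each `A γ`, this sum is
again a retract of `M`, hence a summand of `N`.

If the rank were infinite, independent `a n` with `φ (a n) = 1/(n+1)` would put all `b n = (n+1) a n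
- a 0` in `ker φ`. In a complement of their pure closure, the component of `a 0` is divisible by
every `n + 1`, so it vanishes by reducedness, and `φ (a 0) = 0`, a contradiction. For homogeneity,
reducedness and the rank-one summands give endomorphisms carrying `a` into `pureSpan b` and back
(`exists_endomorphism_mem_pureSpan`), which forces equal types.

(3) ⇒ (2): rank-one groups of equal type are isomorphic, so `N ≅ T^n` with `T` of rank one. A pure
subgroup traces a pure subgroup of `ℤ^n`, and the integer matrix of a retraction onto the latter
acts on `T^n` as a retraction onto the former (`isPureSplit_pi`).

(2) ⇒ (1): compose with the projection onto the summand. -/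

/-! ### Purity, pure closures and rank-one groups inside `ℚ`. -/

section PureClosure

variable {N : Type u} [AddCommGroup N]

/-- In a torsion-free group, purity means being closed under division by nonzero integers. -/
theorem isPureSubgroup_iff [IsAddTorsionFree N] {L : AddSubgroup N} :
    IsPureSubgroup L ↔ ∀ n : ℤ, n ≠ 0 → ∀ x, n • x ∈ L → x ∈ L := by
  constructor
  · intro h n hn x hx
    have hmem : n • x ∈ L ⊓ (zsmulAddGroupHom n : N →+ N).range := ⟨hx, x, rfl⟩
    rw [← h n] at hmem
    obtain ⟨y, hy, hxy⟩ := hmem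
    rwa [smul_right_injective N hn (show n • y = n • x from hxy)] at hy
  · intro h n
    ext x
    constructor
    · rintro ⟨y, hy, rfl⟩
      exact ⟨L.zsmul_mem hy n, y, rfl⟩
    · rintro ⟨hx, y, rfl⟩
      by_cases hn : n = 0
      · exact ⟨0, L.zero_mem, by simp [hn]⟩
      · exact ⟨y, h n hn y hx, rfl⟩

/-- The elements having a nonzero multiple in `S`. -/
def pureClosure (S : AddSubgroup N) : AddSubgroup N where
  carrier := {x | ∃ n : ℤ, n ≠ 0 ∧ n • x ∈ S}
  zero_mem' := ⟨1, one_ne_zero, by simp⟩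
  add_mem' := by
    rintro x y ⟨m, hm, hx⟩ ⟨n, hn, hy⟩
    refine ⟨m * n, mul_ne_zero hm hn, ?_⟩
    rw [smul_add, mul_comm m n, mul_smul, mul_comm n m, mul_smul]
    exact S.add_mem (S.zsmul_mem hx n) (S.zsmul_mem hy m)
  neg_mem' := by
    rintro x ⟨m, hm, hx⟩
    exact ⟨m, hm, by simpa using hx⟩

theorem mem_pureClosure {S : AddSubgroup N} {x : N} :
    x ∈ pureClosure S ↔ ∃ n : ℤ, n ≠ 0 ∧ n • x ∈ S := Iff.rfl

theorem le_pureClosure (S : AddSubgroup N) : S ≤ pureClosure S :=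
  fun x hx => ⟨1, one_ne_zero, by simpa using hx⟩

theorem mem_pureClosure_of_zsmul_mem {S : AddSubgroup N} {n : ℤ} (hn : n ≠ 0) {x : N}
    (hx : n • x ∈ pureClosure S) : x ∈ pureClosure S := by
  obtain ⟨m, hm, hx⟩ := hx
  exact ⟨m * n, mul_ne_zero hm hn, by rwa [mul_smul]⟩

theorem pureClosure_le {S T : AddSubgroup N} (h : S ≤ pureClosure T) :
    pureClosure S ≤ pureClosure T := by
  rintro x ⟨n, hn, hx⟩
  exact mem_pureClosure_of_zsmul_mem hn (h hx)

theorem isPureSubgroup_pureClosure [IsAddTorsionFree N] (S : AddSubgroup N) :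
    IsPureSubgroup (pureClosure S) :=
  isPureSubgroup_iff.2 fun _ hn _ hx => mem_pureClosure_of_zsmul_mem hn hx

/-- The pure subgroup generated by one element. -/
abbrev pureSpan (a : N) : AddSubgroup N := pureClosure (AddSubgroup.zmultiples a)

theorem mem_pureSpan {a x : N} : x ∈ pureSpan a ↔ ∃ n : ℤ, n ≠ 0 ∧ ∃ m : ℤ, n • x = m • a := by
  simp only [mem_pureClosure, AddSubgroup.mem_zmultiples_iff, eq_comm]

theorem self_mem_pureSpan (a : N) : a ∈ pureSpan a :=
  le_pureClosure _ (AddSubgroup.mem_zmultiples a)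

theorem pureSpan_le {a : N} {T : AddSubgroup N} (h : a ∈ pureClosure T) :
    pureSpan a ≤ pureClosure T :=
  pureClosure_le (by simpa using h)

theorem ne_zero_of_zsmul_eq_zsmul [IsAddTorsionFree N] {a x : N} {n m : ℤ} (hn : n ≠ 0)
    (hx : x ≠ 0) (h : n • x = m • a) : m ≠ 0 := by
  rintro rfl
  rw [zero_smul] at h
  exact (smul_ne_zero hn hx) h

/-- A homomorphism is determined on a pure span by its value at the generator. -/
theorem map_eq_zero_of_mem_pureSpan [IsAddTorsionFree N] {M : Type v} [AddCommGroup M]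
    [IsAddTorsionFree M] (f : N →+ M) {a x : N} (hx : x ∈ pureSpan a) (ha : f a = 0) :
    f x = 0 := by
  obtain ⟨n, hn, m, h⟩ := mem_pureSpan.1 hx
  have := congrArg f h
  rw [map_zsmul, map_zsmul, ha, smul_zero] at this
  exact (smul_eq_zero.1 this).resolve_left hn

theorem map_eq_self_of_mem_pureSpan [IsAddTorsionFree N] (f : N →+ N) {a x : N}
    (hx : x ∈ pureSpan a) (ha : f a = a) : f x = x := by
  have := map_eq_zero_of_mem_pureSpan (f - AddMonoidHom.id N) hx (by simp [ha])
  simpa [sub_eq_zero] using this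

/-- A family `a` of elements independent over `ℤ` can be sent to arbitrary rationals. -/
theorem exists_hom_rat_of_linearIndependent {ι : Type*} {a : ι → N}
    (ha : LinearIndependent ℤ a) (q : ι → ℚ) : ∃ φ : N →+ ℚ, ∀ i, φ (a i) = q i := by
  -- Independence is injectivity of `Finsupp.linearCombination`, along which maps into the divisible
  -- group `ℚ` extend.
  obtain ⟨h, hh⟩ := (Module.Baer.of_divisible ℚ).extension_property_addMonoidHom
    (Finsupp.linearCombination ℤ a).toAddMonoidHom ha
    (Finsupp.linearCombination ℤ q).toAddMonoidHom
  refine ⟨h, fun i => ?_⟩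
  simpa using DFunLike.congr_fun hh (Finsupp.single i 1)

theorem exists_hom_rat_eq_one [IsAddTorsionFree N] {a : N} (ha : a ≠ 0) :
    ∃ φ : N →+ ℚ, φ a = 1 := by
  obtain ⟨φ, hφ⟩ := exists_hom_rat_of_linearIndependent (N := N) (ι := Unit) (a := fun _ => a)
    (LinearIndependent.of_subsingleton () ha) (fun _ => 1)
  exact ⟨φ, hφ ()⟩

theorem exists_injective_hom_rat_of_forall_mem_pureSpan [IsAddTorsionFree N] {a : N}
    (ha : a ≠ 0) (h : ∀ x, x ∈ pureSpan a) :
    ∃ φ : N →+ ℚ, φ a = 1 ∧ Function.Injective φ := by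
  obtain ⟨φ, hφ⟩ := exists_hom_rat_eq_one ha
  refine ⟨φ, hφ, (injective_iff_map_eq_zero φ).2 fun x hx => ?_⟩
  obtain ⟨n, hn, m, hnm⟩ := mem_pureSpan.1 (h x)
  have h1 := congrArg φ hnm
  rw [map_zsmul, map_zsmul, hx, hφ, smul_zero] at h1
  have hm : m = 0 := by simpa using h1.symm
  rw [hm, zero_smul] at hnm
  exact (smul_eq_zero.1 hnm).resolve_left hn

theorem exists_rat_subgroup_equiv_pureSpan [IsAddTorsionFree N] {a : N} (ha : a ≠ 0) :
    ∃ H : AddSubgroup ℚ, H ≠ ⊥ ∧ Nonempty (pureSpan a ≃+ H) := by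
  obtain ⟨φ, h1, hφ⟩ := exists_injective_hom_rat_of_forall_mem_pureSpan
    (N := pureSpan a) (a := ⟨a, self_mem_pureSpan a⟩) (by simpa using ha) (by
      rintro ⟨x, hx⟩
      obtain ⟨n, hn, m, h⟩ := mem_pureSpan.1 hx
      exact mem_pureSpan.2 ⟨n, hn, m, Subtype.ext h⟩)
  refine ⟨φ.range, fun hb => ?_, ⟨AddMonoidHom.ofInjective hφ⟩⟩
  have : (1 : ℚ) ∈ φ.range := ⟨_, h1⟩
  rw [hb] at this
  simp at this

theorem Rat.exists_zsmul_eq_zsmul {x : ℚ} (a : ℚ) (hx : x ≠ 0) :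
    ∃ n : ℤ, n ≠ 0 ∧ ∃ m : ℤ, n • a = m • x := by
  refine ⟨a.den * x.num, mul_ne_zero (by simp) (by simpa using hx), a.num * x.den, ?_⟩
  have h1 := Rat.mul_den_eq_num a
  have h2 := Rat.mul_den_eq_num x
  simp only [zsmul_eq_mul, Int.cast_mul, Int.cast_natCast]
  rw [← h1, ← h2]
  ring

/-- Any two nonzero rationals have a common nonzero multiple. -/
theorem isUniformAbelianGroup_rat_subgroup {H : AddSubgroup ℚ} (hH : H ≠ ⊥) :
    IsUniformAbelianGroup H := by
  refine ⟨H.bot_or_nontrivial.resolve_left hH, fun A B hA hB hAB => ?_⟩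
  simp only [ne_eq, AddSubgroup.eq_bot_iff_forall, not_forall] at hA hB
  obtain ⟨a, ha, ha0⟩ := hA
  obtain ⟨b, hb, hb0⟩ := hB
  obtain ⟨n, hn, m, h⟩ := Rat.exists_zsmul_eq_zsmul ((a : H) : ℚ) (x := ((b : H) : ℚ))
    (by simpa using hb0)
  have h' : n • (a : H) = m • (b : H) := Subtype.ext h
  have hmem : n • (a : H) ∈ A ⊓ B := ⟨A.zsmul_mem ha n, h' ▸ B.zsmul_mem hb m⟩
  rw [hAB, AddSubgroup.mem_bot] at hmem
  exact smul_ne_zero hn ha0 hmem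

theorem IsUniformAbelianGroup.of_equiv {A : Type v} {B : Type w} [AddCommGroup A] [AddCommGroup B]
    (e : A ≃+ B) (h : IsUniformAbelianGroup A) : IsUniformAbelianGroup B := by
  have := h.1
  refine ⟨e.symm.toEquiv.nontrivial, fun H K hH hK hHK => ?_⟩
  have key : ∀ H : AddSubgroup B, H ≠ ⊥ → H.comap e.toAddMonoidHom ≠ ⊥ := by
    intro H hH hb
    refine hH ((AddSubgroup.eq_bot_iff_forall _).2 fun x hx => ?_)
    have : e.symm x ∈ H.comap e.toAddMonoidHom := by simpa using hx
    rw [hb, AddSubgroup.mem_bot] at this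
    simpa using this
  refine h.2 _ _ (key H hH) (key K hK) ((AddSubgroup.eq_bot_iff_forall _).2 fun x hx => ?_)
  have : e x ∈ H ⊓ K := hx
  rw [hHK, AddSubgroup.mem_bot] at this
  simpa using this

end PureClosure

/-! ### Gram–Schmidt for pure spans. -/

section OrthogonalProjections

variable {N : Type u} [AddCommGroup N]

/-- Given projections `ρ c` onto the pure spans and a sequence `a`, the projection killing the pure
spans split off from the first `n` members of the sequence. -/
noncomputable def complementaryProjection (ρ : N → N →+ N) (a : ℕ → N) : ℕ → N →+ N
  | 0 => AddMonoidHom.id N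
  | n + 1 => complementaryProjection ρ a n -
      (ρ (complementaryProjection ρ a n (a n))).comp (complementaryProjection ρ a n)

/-- A sequence of elements with orthogonal projections onto their pure spans, which together
decompose the pure closure of the span of a given sequence. -/
theorem exists_orthogonal_projections [IsAddTorsionFree N]
    (hN : ∀ c : N, ∃ ρ : N →+ N, (∀ x, ρ x ∈ pureSpan c) ∧ ∀ x ∈ pureSpan c, ρ x = x)
    (a : ℕ → N) :
    ∃ (c : ℕ → N) (e : ℕ → N →+ N),
      (∀ n x, e n x ∈ pureSpan (c n)) ∧ (∀ n, ∀ x ∈ pureSpan (c n), e n x = x) ∧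
      (∀ m n, m ≠ n → ∀ x ∈ pureSpan (c n), e m x = 0) ∧
      (∀ n, c n ∈ pureClosure (AddSubgroup.closure (Set.range a))) ∧
      ∀ n, a n = ∑ i ∈ Finset.range (n + 1), e i (a n) := by
  choose ρ hρ hρ' using hN
  set π := complementaryProjection ρ a with hπ
  -- What remains of `a n` after the earlier spans are split off; it may be zero.
  let c : ℕ → N := fun n => π n (a n)
  let e : ℕ → N →+ N := fun n => (ρ (c n)).comp (π n)
  have he : ∀ n x, e n x = ρ (c n) (π n x) := fun _ _ => rfl
  have hs : ∀ n x, π (n + 1) x = π n x - e n x := fun _ _ => rfl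
  have emem : ∀ n, ∀ x, e n x ∈ pureSpan (c n) := fun n x => hρ _ _
  have fix : ∀ n, (∀ x, π n (π n x) = π n x) → ∀ x ∈ pureSpan (c n), π n x = x :=
    fun n h x hx => map_eq_self_of_mem_pureSpan _ hx (h _)
  have idem : ∀ n x, π n (π n x) = π n x := by
    intro n
    induction n with
    | zero => intro x; rfl
    | succ n ih =>
      intro x
      have h1 : π n (e n x) = e n x := fix n ih _ (hρ _ _)
      have h2 : e n (π n x) = e n x := by rw [he, ih, ← he]
      have h3 : e n (e n x) = e n x := by rw [he n (e n x), h1, hρ' _ _ (emem n x)]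
      rw [hs n x, map_sub, hs, hs, ih, h1, h2, h3]
      abel
  have fix' : ∀ n, ∀ x ∈ pureSpan (c n), π n x = x := fun n => fix n (idem n)
  have efix : ∀ n, ∀ x ∈ pureSpan (c n), e n x = x := fun n x hx => by
    rw [he, fix' n x hx, hρ' _ _ hx]
  have kill : ∀ n, ∀ x ∈ pureSpan (c n), π (n + 1) x = 0 := fun n x hx => by
    rw [hs, fix' n x hx, efix n x hx, sub_self]
  have step1 : ∀ n x, π (n + 1) (π n x) = π (n + 1) x := fun n x => by
    rw [hs, hs, idem, he, idem, ← he]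
  have step2 : ∀ n x, π n (π (n + 1) x) = π (n + 1) x := fun n x => by
    rw [hs, map_sub, idem, fix' n (e n x) (hρ _ _)]
  have abs1 : ∀ m n, m ≤ n → ∀ x, π n (π m x) = π n x := by
    intro m n h
    induction n, h using Nat.le_induction with
    | base => exact idem m
    | succ n _ ih => intro x; rw [← step1, ih, step1]
  have abs2 : ∀ m n, m ≤ n → ∀ x, π m (π n x) = π n x := by
    intro m n h
    induction n, h using Nat.le_induction with
    | base => exact idem m
    | succ n _ ih => intro x; rw [← step2, ih]
  have expand : ∀ n x, x = π n x + ∑ i ∈ Finset.range n, e i x := by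
    intro n x
    induction n with
    | zero => simp [hπ, complementaryProjection]
    | succ n ih =>
      rw [Finset.sum_range_succ, hs]
      nth_rewrite 1 [ih]
      abel
  refine ⟨c, e, emem, efix, ?_, ?_, ?_⟩
  · intro m n hmn x hx
    rcases lt_or_gt_of_ne hmn with h | h
    -- For `m < n`, `x` is fixed by both `π m` and `π (m + 1)`, whose difference is `e m`. In the
    -- other case `π m` factors through `π (n + 1)`, which kills `x`.
    · have h1 : x = π (m + 1) x := by
        rw [← fix' n x hx, abs2 (m + 1) n h]
      have h2 : π m x = x := by rw [← fix' n x hx, abs2 m n h.le]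
      have h3 := hs m x
      rw [h2] at h3
      exact sub_eq_self.1 (h1.trans h3).symm
    · rw [he, ← abs1 (n + 1) m h, kill n x hx, map_zero, map_zero]
  · intro n
    induction n using Nat.strong_induction_on with
    | _ n ih =>
      have h1 : c n = a n - ∑ i ∈ Finset.range n, e i (a n) :=
        eq_sub_of_add_eq (expand n (a n)).symm
      rw [h1]
      refine sub_mem (le_pureClosure _ (AddSubgroup.subset_closure ⟨n, rfl⟩))
        (sum_mem fun i hi => ?_)
      exact pureSpan_le (ih i (Finset.mem_range.1 hi)) (emem i _)
  · intro n
    have h1 : π (n + 1) (a n) = 0 := by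
      rw [← step1]; exact kill n _ (self_mem_pureSpan _)
    have := expand (n + 1) (a n)
    rwa [h1, zero_add] at this

/-- If all pure subgroups generated by one element are direct summands, then pure subgroups of
countable rank are direct sums of such subgroups. -/
theorem exists_pureClosure_eq_directSum [IsAddTorsionFree N]
    (hN : ∀ c : N, ∃ ρ : N →+ N, (∀ x, ρ x ∈ pureSpan c) ∧ ∀ x ∈ pureSpan c, ρ x = x)
    (a : ℕ → N) :
    ∃ c : ℕ → N,
      Function.Injective (DirectSum.coeAddMonoidHom fun n => pureSpan (c n)) ∧
      (DirectSum.coeAddMonoidHom fun n => pureSpan (c n)).range =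
        pureClosure (AddSubgroup.closure (Set.range a)) := by
  obtain ⟨c, e, emem, efix, eort, cmem, asum⟩ := exists_orthogonal_projections hN a
  refine ⟨c, ?_, ?_⟩
  · have key : ∀ i (x : DirectSum ℕ fun n => pureSpan (c n)),
        e i (DirectSum.coeAddMonoidHom (fun n => pureSpan (c n)) x) = x i := by
      intro i x
      induction x using DirectSum.induction_on with
      | zero => simp
      | of j y =>
        rw [DirectSum.coeAddMonoidHom_of, DirectSum.coe_of_apply]
        split_ifs with h
        · subst h; exact efix _ _ y.2
        · exact eort i j (Ne.symm h) _ y.2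
      | add x y hx hy => simp [hx, hy]
    intro x y hxy
    ext i
    rw [← key, ← key, hxy]
  · set g := DirectSum.coeAddMonoidHom fun n => pureSpan (c n) with hg
    have hmem : ∀ i, ∀ x ∈ pureSpan (c i), x ∈ g.range := fun i x hx =>
      ⟨DirectSum.of (fun n => pureSpan (c n)) i ⟨x, hx⟩, by rw [hg, DirectSum.coeAddMonoidHom_of]⟩
    apply le_antisymm
    · rintro _ ⟨x, rfl⟩
      induction x using DirectSum.induction_on with
      | zero => simp
      | of j y =>
        rw [hg, DirectSum.coeAddMonoidHom_of]
        exact pureSpan_le (cmem j) y.2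
      | add x y hx hy => rw [map_add]; exact add_mem hx hy
    -- Asking for the expansion at all `k ≥ m` lets two elements be compared at the larger bound.
    · have hsum : ∀ y ∈ AddSubgroup.closure (Set.range a),
          ∃ m, ∀ k, m ≤ k → y = ∑ i ∈ Finset.range k, e i y := by
        intro y hy
        induction hy using AddSubgroup.closure_induction with
        | mem y hy =>
          obtain ⟨n, rfl⟩ := hy
          refine ⟨n + 1, fun k hk => ?_⟩
          induction k, hk using Nat.le_induction with
          | base => exact asum n
          | succ k hk ih =>
            have h0 : e k (a n) = 0 := by
              rw [asum n, map_sum]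
              refine Finset.sum_eq_zero fun i hi => eort _ _ ?_ _ (emem i _)
              have := Finset.mem_range.1 hi
              omega
            rw [Finset.sum_range_succ, h0, add_zero]
            exact ih
        | zero => exact ⟨0, by simp⟩
        | add x y _ _ hx hy =>
          obtain ⟨m, hm⟩ := hx
          obtain ⟨n, hn⟩ := hy
          refine ⟨max m n, fun k hk => ?_⟩
          simp only [map_add, Finset.sum_add_distrib]
          rw [← hm k (le_trans (le_max_left _ _) hk), ← hn k (le_trans (le_max_right _ _) hk)]
        | neg x _ hx =>
          obtain ⟨m, hm⟩ := hx
          refine ⟨m, fun k hk => ?_⟩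
          simp only [map_neg, Finset.sum_neg_distrib]
          rw [← hm k hk]
      rintro x ⟨n, hn, hx⟩
      obtain ⟨m, hm⟩ := hsum _ hx
      have h1 : n • x = n • ∑ i ∈ Finset.range m, e i x := by
        rw [Finset.smul_sum]
        simpa using hm m le_rfl
      rw [smul_right_injective N hn h1]
      exact sum_mem fun i _ => hmem i _ (emem i x)

end OrthogonalProjections

/-! ### Retracts of `M` that become summands of `N`. -/

section PureInjective

variable {N : Type u} [AddCommGroup N]

/-- A retract `K` of an `N`-pure-injective group which is a pure subgroup of `N` is a retract
of `N`. -/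
theorem IsPureInjectiveRel.exists_retraction {M : Type v} [AddCommGroup M]
    (hM : IsPureInjectiveRel M N) {K : AddSubgroup N} (hK : IsPureSubgroup K) (i : K →+ M)
    (r : M →+ K) (hri : ∀ x, r (i x) = x) :
    ∃ ρ : N →+ N, (∀ x, ρ x ∈ K) ∧ ∀ x ∈ K, ρ x = x := by
  obtain ⟨g, hg⟩ := hM K hK i
  refine ⟨K.subtype.comp (r.comp g), fun x => (r (g x)).2, fun x hx => ?_⟩
  simp [hg ⟨x, hx⟩, hri]

variable {Γ : Type v} {A : Γ → Type w} [∀ γ, AddCommGroup (A γ)]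

/-- A countable direct sum of retracts of members of `A` is a retract of
`CountableMultiplesSum A`. -/
theorem exists_retract_countableMultiplesSum {L : ℕ → Type u} [∀ n, AddCommGroup (L n)]
    (hL : ∀ n, ∃ γ, ∃ (f : L n →+ A γ) (b : A γ →+ L n), ∀ x, b (f x) = x) :
    ∃ (i : DirectSum ℕ L →+ CountableMultiplesSum A) (r : CountableMultiplesSum A →+ DirectSum ℕ L),
      ∀ x, r (i x) = x := by
  classical
  choose γ f b hb using hL
  -- `L n` goes into the `n`-th copy of `A (γ n)`, so no copy is used twice even if `γ` repeats
  -- values.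
  let i : DirectSum ℕ L →+ CountableMultiplesSum A := DirectSum.toAddMonoid fun n =>
    (DirectSum.of (fun γ => ℕ →₀ A γ) (γ n)).comp ((Finsupp.singleAddHom n).comp (f n))
  let s : ∀ (δ : Γ) (n : ℕ), A δ →+ DirectSum ℕ L := fun δ n =>
    if h : γ n = δ then h ▸ (DirectSum.of L n).comp (b n) else 0
  let r : CountableMultiplesSum A →+ DirectSum ℕ L := DirectSum.toAddMonoid fun δ =>
    Finsupp.liftAddHom (s δ)
  refine ⟨i, r, fun x => ?_⟩
  induction x using DirectSum.induction_on with
  | zero => simp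
  | of n y =>
    have hs : s (γ n) n = (DirectSum.of L n).comp (b n) := dif_pos rfl
    simp [i, r, hs, hb]
  | add x y hx hy => simp [hx, hy]

theorem IsCompleteUniformFamily.exists_equiv (hA : IsCompleteUniformFamily A)
    {H : AddSubgroup ℚ} (hH : H ≠ ⊥) : ∃ γ, Nonempty (H ≃+ A γ) := by
  -- `exists_iso` only sees groups in `Type w`.
  have hU : IsUniformAbelianGroup (ULift.{w} H) :=
    (isUniformAbelianGroup_rat_subgroup hH).of_equiv AddEquiv.ulift.symm
  obtain ⟨γ, ⟨e⟩⟩ := hA.exists_iso _ hU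
  exact ⟨γ, ⟨AddEquiv.ulift.symm.trans e⟩⟩

theorem IsCompleteUniformFamily.exists_retract_pureSpan [IsAddTorsionFree N]
    (hA : IsCompleteUniformFamily A) (c : N) :
    ∃ γ, ∃ (f : pureSpan c →+ A γ) (b : A γ →+ pureSpan c), ∀ x, b (f x) = x := by
  by_cases hc : c = 0
  -- The zero span is not uniform, but it is a retract of anything; `ℚ` itself shows that some `γ`
  -- exists.
  · obtain ⟨γ, -⟩ := hA.exists_equiv (H := ⊤) top_ne_bot
    refine ⟨γ, 0, 0, fun x => ?_⟩
    exact Subtype.ext (map_eq_zero_of_mem_pureSpan (AddMonoidHom.id N) x.2 hc).symm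
  · obtain ⟨H, hH, ⟨e⟩⟩ := exists_rat_subgroup_equiv_pureSpan hc
    obtain ⟨γ, ⟨e'⟩⟩ := hA.exists_equiv hH
    exact ⟨γ, (e.trans e').toAddMonoidHom, (e.trans e').symm.toAddMonoidHom, fun x => by simp⟩

theorem exists_retraction_pureSpan [IsAddTorsionFree N] (hA : IsCompleteUniformFamily A)
    (hM : IsPureInjectiveRel (CountableMultiplesSum A) N) (c : N) :
    ∃ ρ : N →+ N, (∀ x, ρ x ∈ pureSpan c) ∧ ∀ x ∈ pureSpan c, ρ x = x := by
  classical
  obtain ⟨i, r, hri⟩ := exists_retract_countableMultiplesSum (A := A)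
    (L := fun _ : ℕ => pureSpan c) fun _ => hA.exists_retract_pureSpan c
  refine hM.exists_retraction (isPureSubgroup_pureClosure _)
    (i.comp (DirectSum.of (fun _ : ℕ => pureSpan c) 0))
    ((DirectSum.toAddMonoid fun _ => AddMonoidHom.id _).comp r) fun x => ?_
  simp [hri]

theorem exists_retraction_pureClosure_range [IsAddTorsionFree N]
    (hA : IsCompleteUniformFamily A)
    (hM : IsPureInjectiveRel (CountableMultiplesSum A) N) (a : ℕ → N) :
    ∃ ρ : N →+ N, (∀ x, ρ x ∈ pureClosure (AddSubgroup.closure (Set.range a))) ∧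
      ∀ x ∈ pureClosure (AddSubgroup.closure (Set.range a)), ρ x = x := by
  obtain ⟨c, hinj, hrange⟩ :=
    exists_pureClosure_eq_directSum (exists_retraction_pureSpan hA hM) a
  obtain ⟨i, r, hri⟩ := exists_retract_countableMultiplesSum (A := A)
    (L := fun n : ℕ => pureSpan (c n)) fun n => hA.exists_retract_pureSpan (c n)
  let e := (AddMonoidHom.ofInjective hinj).trans (AddEquiv.addSubgroupCongr hrange)
  exact hM.exists_retraction (isPureSubgroup_pureClosure _) (i.comp e.symm.toAddMonoidHom)
    (e.toAddMonoidHom.comp r) fun x => by simp [hri]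

end PureInjective

/-! ### Consequences of reducedness: finite rank and endomorphisms between spans. -/

section Reduced

variable {N : Type u} [AddCommGroup N] [IsAddTorsionFree N]

theorem isDivisibleGroup_pureClosure {S : AddSubgroup N}
    (h : ∀ n : ℕ, 0 < n → ∀ x ∈ S, ∃ y : N, n • y = x) : IsDivisibleGroup (pureClosure S) := by
  rintro n hn ⟨x, m, hm, hx⟩
  -- From `n|m| y = m x`, cancelling `m` shows that `n` times `sign(m) y` is `x`.
  obtain ⟨y, hy⟩ := h (n * m.natAbs) (by positivity) _ hx
  have hn' : (n : ℤ) ≠ 0 := by exact_mod_cast hn.ne'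
  have hyS : y ∈ pureClosure S :=
    mem_pureClosure.2 ⟨n * m.natAbs, mul_ne_zero hn' (by simpa using hm), by
      have : ((n * m.natAbs : ℕ) : ℤ) • y ∈ S := by rw [natCast_zsmul, hy]; exact hx
      exact_mod_cast this⟩
  refine ⟨⟨m.sign • y, zsmul_mem hyS _⟩, Subtype.ext (smul_right_injective N hm ?_)⟩
  show m • n • m.sign • y = m • x
  rw [← hy, ← natCast_zsmul, ← natCast_zsmul, smul_smul, smul_smul, Nat.cast_mul,
    ← Int.sign_mul_self_eq_natAbs]
  congr 1
  ring

/-- A reduced torsion-free group in which the pure subgroups of countable rank are direct summands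
has finite rank. -/
theorem rank_lt_aleph0_of_exists_retraction (hN : IsReducedGroup N)
    (h : ∀ a : ℕ → N, ∃ ρ : N →+ N,
      (∀ x, ρ x ∈ pureClosure (AddSubgroup.closure (Set.range a))) ∧
      ∀ x ∈ pureClosure (AddSubgroup.closure (Set.range a)), ρ x = x) :
    Module.rank ℤ N < Cardinal.aleph0 := by
  by_contra! hr
  obtain ⟨a, ha⟩ : ∃ a : ℕ → N, LinearIndependent ℤ a := by
    obtain ⟨s, hs, hli⟩ := exists_set_linearIndependent ℤ N
    rw [← hs, Cardinal.aleph0_le_mk_iff] at hr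
    exact ⟨_, LinearIndependent.comp hli _ (Infinite.natEmbedding s).injective⟩
  obtain ⟨φ, hφ⟩ := exists_hom_rat_of_linearIndependent ha fun n => 1 / ((n : ℚ) + 1)
  let b : ℕ → N := fun n => (n + 1) • a n - a 0
  have hb : ∀ x ∈ pureClosure (AddSubgroup.closure (Set.range b)), φ x = 0 := by
    rintro x ⟨n, hn, hx⟩
    have hle : AddSubgroup.closure (Set.range b) ≤ φ.ker := by
      rw [AddSubgroup.closure_le]
      rintro _ ⟨n, rfl⟩
      have : (n : ℚ) + 1 ≠ 0 := by positivity
      simp only [SetLike.mem_coe, AddMonoidHom.mem_ker, b, map_sub, map_nsmul, hφ, nsmul_eq_mul]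
      push_cast
      field_simp
      simp
    have h0 : φ (n • x) = 0 := hle hx
    rw [map_zsmul] at h0
    exact (smul_eq_zero.1 h0).resolve_left hn
  obtain ⟨ρ, hρ, hρ'⟩ := h b
  -- The component of `a n` in the complement; since `ρ` fixes `b n`, the relation becomes `(n+1) d
  -- n = d 0`.
  let d : ℕ → N := fun n => a n - ρ (a n)
  have hd : ∀ n, (n + 1) • d n = d 0 := by
    intro n
    have h1 := hρ' (b n) (le_pureClosure _ (AddSubgroup.subset_closure ⟨n, rfl⟩))
    have h2 : ρ (b n) = (n + 1) • ρ (a n) - ρ (a 0) := by simp only [b, map_sub, map_nsmul]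
    rw [h2] at h1
    simp only [d, smul_sub]
    have h3 : (n + 1) • ρ (a n) = b n + ρ (a 0) := by rw [← h1]; abel
    rw [h3]
    simp only [b]
    abel
  have hdiv : IsDivisibleGroup (pureSpan (d 0)) := by
    refine isDivisibleGroup_pureClosure fun n hn x hx => ?_
    obtain ⟨m, rfl⟩ := AddSubgroup.mem_zmultiples_iff.1 hx
    refine ⟨m • d (n - 1), ?_⟩
    rw [smul_comm, ← hd (n - 1), Nat.sub_add_cancel hn]
  have hd0 : d 0 = 0 := by
    have := self_mem_pureSpan (d 0)
    rwa [hN _ hdiv, AddSubgroup.mem_bot] at this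
  have h1 : φ (a 0) = 0 := hb _ (by rw [sub_eq_zero.1 hd0]; exact hρ _)
  rw [hφ] at h1
  simp at h1

/-- In a reduced torsion-free group whose pure subgroups of rank one are direct summands, any two
nonzero elements are related by an endomorphism up to multiples. -/
theorem exists_endomorphism_mem_pureSpan (hN : IsReducedGroup N)
    (h : ∀ c : N, ∃ ρ : N →+ N, (∀ x, ρ x ∈ pureSpan c) ∧ ∀ x ∈ pureSpan c, ρ x = x)
    {a b : N} (ha : a ≠ 0) (hb : b ≠ 0) : ∃ f : N →+ N, f a ≠ 0 ∧ f a ∈ pureSpan b := by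
  by_contra! hf
  obtain ⟨e, he, he'⟩ := h b
  have hea : e a = 0 := by
    by_contra h0
    exact hf e h0 (he a)
  -- Otherwise `pureSpan a` would be divisible.
  obtain ⟨n, hn, x, hx, hnx⟩ : ∃ n : ℕ, 0 < n ∧ ∃ x ∈ AddSubgroup.zmultiples a,
      ∀ y : N, n • y ≠ x := by
    by_contra! hdiv
    have h1 := hN _ (isDivisibleGroup_pureClosure hdiv)
    exact ha (AddSubgroup.mem_bot.1 (h1 ▸ self_mem_pureSpan a))
  obtain ⟨m, rfl⟩ := AddSubgroup.mem_zmultiples_iff.1 hx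
  set k := n • b + m • a with hk
  have hek : e k = n • b := by
    rw [hk, map_add, map_nsmul, map_zsmul, hea, he' b (self_mem_pureSpan b), smul_zero, add_zero]
  obtain ⟨r, hr, hr'⟩ := h k
  -- `e.comp r` carries `a` into `pureSpan b`, so it kills `a`; and `e` is injective on `pureSpan k`
  -- because `e k = n • b ≠ 0`.
  have hra : r a = 0 := by
    have h1 : e (r a) = 0 := by
      by_contra h0
      exact hf (e.comp r) h0 (he _)
    obtain ⟨i, hi, j, hij⟩ := mem_pureSpan.1 (hr a)
    have h2 := congrArg e hij
    rw [map_zsmul, map_zsmul, h1, smul_zero, hek] at h2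
    have hj : j = 0 := (smul_eq_zero.1 h2.symm).resolve_right (smul_ne_zero hn.ne' hb)
    rw [hj, zero_smul] at hij
    exact (smul_eq_zero.1 hij).resolve_left hi
  have h1 := hr' k (self_mem_pureSpan k)
  have h2 : r k = n • r b := by rw [hk, map_add, map_nsmul, map_zsmul, hra, smul_zero, add_zero]
  -- Now `k = r k = n • r b`, so `n` divides `m • a`, contrary to the choice of `n` and `m`.
  refine hnx (r b - b) ?_
  rw [smul_sub, ← h2, h1, hk]
  abel

end Reduced

/-! ### Complete decomposability from rank-one summands. -/

section CompletelyDecomposable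

variable {N : Type u} [AddCommGroup N]

theorem exists_seq_pureClosure_eq_top (hr : Module.rank ℤ N < Cardinal.aleph0) :
    ∃ a : ℕ → N, pureClosure (AddSubgroup.closure (Set.range a)) = ⊤ := by
  obtain ⟨s, hs, hmax⟩ := exists_maximal_linearIndepOn ℤ (id : N → N)
  have hcard : Cardinal.mk s < Cardinal.aleph0 :=
    hs.linearIndependent.cardinal_le_rank.trans_lt hr
  -- Adding `0` makes the set nonempty, hence the range of a sequence.
  have hc : (insert 0 s).Countable :=
    ((Set.finite_coe_iff.1 (Cardinal.lt_aleph0_iff_finite.1 hcard)).countable).insert 0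
  obtain ⟨a, ha⟩ := hc.exists_eq_range ⟨0, Set.mem_insert _ _⟩
  refine ⟨a, (AddSubgroup.eq_top_iff' _).2 fun x => ?_⟩
  rw [← ha]
  by_cases hx : x ∈ s
  · exact le_pureClosure _ (AddSubgroup.subset_closure (Set.mem_insert_of_mem _ hx))
  · obtain ⟨n, hn, hnx⟩ := hmax x hx
    refine ⟨n, hn, ?_⟩
    rw [Set.image_id, ← Submodule.mem_toAddSubgroup, Submodule.span_int_eq_addSubgroupClosure] at hnx
    exact AddSubgroup.closure_mono (Set.subset_insert _ _) hnx

theorem isCompletelyDecomposable_of_exists_retraction [IsAddTorsionFree N]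
    (h : ∀ c : N, ∃ ρ : N →+ N, (∀ x, ρ x ∈ pureSpan c) ∧ ∀ x ∈ pureSpan c, ρ x = x)
    (hr : Module.rank ℤ N < Cardinal.aleph0) : IsCompletelyDecomposable N := by
  classical
  obtain ⟨a, ha⟩ := exists_seq_pureClosure_eq_top hr
  obtain ⟨c, hinj, hrange⟩ := exists_pureClosure_eq_directSum h a
  rw [ha, AddMonoidHom.range_eq_top] at hrange
  have hint : DirectSum.IsInternal fun n => AddSubgroup.toIntSubmodule (pureSpan (c n)) :=
    ⟨hinj, hrange⟩
  rw [DirectSum.isInternal_submodule_iff_iSupIndep_and_iSup_eq_top] at hint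
  -- Zero spans are dropped, as each summand must be a nonzero subgroup of `ℚ`.
  let ι := ULift.{u} {n // c n ≠ 0}
  let g : ι → ℕ := fun i => i.down.1
  have hg : Function.Injective g := Subtype.val_injective.comp ULift.down_injective
  have hι : DirectSum.IsInternal fun i : ι => AddSubgroup.toIntSubmodule (pureSpan (c (g i))) := by
    rw [DirectSum.isInternal_submodule_iff_iSupIndep_and_iSup_eq_top]
    refine ⟨hint.1.comp hg, eq_top_iff.2 (hint.2.ge.trans (iSup_le fun n => ?_))⟩
    by_cases hn : c n = 0
    · intro x hx
      rw [show x = 0 from map_eq_zero_of_mem_pureSpan (AddMonoidHom.id N) hx hn]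
      exact zero_mem _
    · exact le_iSup (fun i : ι => AddSubgroup.toIntSubmodule (pureSpan (c (g i)))) ⟨⟨n, hn⟩⟩
  exact ⟨ι, inferInstance, fun i => pureSpan (c (g i)), hι, fun i =>
    exists_rat_subgroup_equiv_pureSpan i.down.2⟩

end CompletelyDecomposable

/-! ### Heights and types under endomorphisms. -/

section Heights

variable {N : Type u} [AddCommGroup N]

/-- The exponents `j` with `p ^ j` dividing `a` are closed downwards. -/
theorem natCast_le_pHeight_iff {p k : ℕ} {a : N} :
    (k : ℕ∞) ≤ pHeight p a ↔ ∃ b : N, p ^ k • b = a := by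
  constructor
  · intro h
    by_contra hk
    have hlt : ∀ j, (∃ b : N, p ^ j • b = a) → j < k := by
      rintro j ⟨b, hb⟩
      by_contra! hkj
      exact hk ⟨p ^ (j - k) • b, by rw [smul_smul, ← pow_add, Nat.add_sub_cancel' hkj, hb]⟩
    rcases Nat.eq_zero_or_pos k with rfl | hpos
    · exact hk ⟨a, by simp⟩
    · have : pHeight p a ≤ ((k - 1 : ℕ) : ℕ∞) := iSup₂_le fun j hj => by
        have := hlt j hj
        exact_mod_cast (by omega : j ≤ k - 1)
      have h2 := h.trans this
      have : k ≤ k - 1 := by exact_mod_cast h2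
      omega
  · intro h
    exact le_iSup₂_of_le k h le_rfl

theorem natCast_le_heightCharacteristic_iff {p : Nat.Primes} {k : ℕ} {a : N} :
    (k : ℕ∞) ≤ heightCharacteristic a p ↔ ∃ b : N, (p : ℕ) ^ k • b = a :=
  natCast_le_pHeight_iff

theorem ENat.le_of_forall_natCast_le {x y : ℕ∞} (h : ∀ k : ℕ, (k : ℕ∞) ≤ x → (k : ℕ∞) ≤ y) :
    x ≤ y := by
  induction x using ENat.recTopCoe with
  | top => exact (ENat.eq_top_iff_forall_ge.2 fun m => h m le_top).ge
  | coe n => exact h n le_rfl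

/-- Divisors of a multiple by a coprime integer are divisors. -/
theorem exists_nsmul_eq_of_isCoprime {k : ℕ} {m : ℤ} (hkm : IsCoprime (k : ℤ) m) {a : N}
    (h : ∃ b : N, k • b = m • a) : ∃ b : N, k • b = a := by
  obtain ⟨u, v, huv⟩ := hkm
  obtain ⟨b, hb⟩ := h
  refine ⟨u • a + v • b, ?_⟩
  rw [smul_add, smul_comm k v b, hb, ← natCast_zsmul, smul_smul, smul_smul, ← add_smul,
    mul_comm (k : ℤ) u, huv, one_smul]

/-- An endomorphism carrying `a` into the pure span of `b` bounds the characteristic of `a` by that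
of `b`, up to finitely many finite differences. -/
theorem heightCharacteristic_le_of_endomorphism [IsAddTorsionFree N] {f : N →+ N} {a b : N}
    (ha : f a ≠ 0) (hab : f a ∈ pureSpan b) :
    {p | ¬ heightCharacteristic a p ≤ heightCharacteristic b p}.Finite ∧
      ∀ p, heightCharacteristic a p = ⊤ → heightCharacteristic b p = ⊤ := by
  obtain ⟨n, hn, m, hm⟩ := mem_pureSpan.1 hab
  have hm0 := ne_zero_of_zsmul_eq_zsmul hn ha hm
  have key : ∀ (k : ℕ), (∃ x : N, k • x = a) → ∃ x : N, k • x = m • b := by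
    rintro k ⟨x, rfl⟩
    refine ⟨n • f x, ?_⟩
    rw [smul_comm, ← map_nsmul, hm]
  constructor
  · have hfin : {p : Nat.Primes | (p : ℕ) ∣ m.natAbs}.Finite := by
      refine Set.Finite.of_finite_image (f := Subtype.val) ?_ Subtype.val_injective.injOn
      refine (m.natAbs.divisors.finite_toSet).subset ?_
      rintro _ ⟨p, hp, rfl⟩
      simpa using ⟨hp, hm0⟩
    refine hfin.subset fun p hp => ?_
    by_contra hpm
    refine hp (ENat.le_of_forall_natCast_le fun k hk => ?_)
    rw [natCast_le_heightCharacteristic_iff] at hk ⊢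
    refine exists_nsmul_eq_of_isCoprime (m := m) ?_ (key _ hk)
    rw [Int.isCoprime_iff_gcd_eq_one, Int.gcd, Int.natAbs_natCast]
    exact ((Nat.Prime.coprime_iff_not_dvd p.2).2 hpm).pow_left k
  · intro p hp
    rw [ENat.eq_top_iff_forall_ge]
    intro k
    -- The surplus exponent `v_p(m)` pays for cancelling the `p`-part of `m`; the cofactor `m'` is
    -- prime to `p`.
    have hpk := (natCast_le_heightCharacteristic_iff (p := p) (a := a)
      (k := k + m.natAbs.factorization p)).1 (by rw [hp]; exact le_top)
    rw [natCast_le_heightCharacteristic_iff]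
    set j := m.natAbs.factorization p with hj
    obtain ⟨x, hx⟩ := key _ hpk
    obtain ⟨m', hm'⟩ : ((p : ℕ) ^ j : ℤ) ∣ m := by
      have := Nat.ordProj_dvd m.natAbs p
      rw [← Int.natCast_dvd] at this
      exact_mod_cast this
    have hp0 : ((p : ℕ) ^ j : ℤ) ≠ 0 := by exact_mod_cast (pow_pos p.2.pos j).ne'
    have hx' : (p : ℕ) ^ k • x = m' • b := by
      apply smul_right_injective N hp0
      show ((p : ℕ) ^ j : ℤ) • (p : ℕ) ^ k • x = ((p : ℕ) ^ j : ℤ) • m' • b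
      rw [smul_smul _ m', ← hm', ← hx, pow_add, mul_comm, mul_smul, ← natCast_zsmul _ (_ ^ j)]
      push_cast
      rfl
    refine exists_nsmul_eq_of_isCoprime (m := m') ?_ ⟨x, hx'⟩
    rw [Int.isCoprime_iff_gcd_eq_one, Int.gcd, Int.natAbs_natCast]
    refine ((Nat.Prime.coprime_iff_not_dvd p.2).2 fun hd => ?_).pow_left k
    have h1 : (p : ℕ) ^ (j + 1) ∣ m.natAbs := by
      rw [hm', Int.natAbs_mul, pow_succ]
      refine mul_dvd_mul ?_ hd
      simp [Int.natAbs_pow]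
    exact Nat.pow_succ_factorization_not_dvd (by simpa using hm0) p.2 h1

theorem elementType_eq_of_endomorphisms [IsAddTorsionFree N] {f g : N →+ N} {a b : N}
    (hfa : f a ≠ 0) (hab : f a ∈ pureSpan b) (hgb : g b ≠ 0) (hba : g b ∈ pureSpan a) :
    elementType a = elementType b := by
  obtain ⟨h1, h2⟩ := heightCharacteristic_le_of_endomorphism hfa hab
  obtain ⟨h3, h4⟩ := heightCharacteristic_le_of_endomorphism hgb hba
  refine Quotient.sound ⟨(h1.union h3).subset fun p hp => ?_, fun p hp => ⟨fun h => ?_, fun h => ?_⟩⟩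
  · by_contra hn
    simp only [Set.mem_union, Set.mem_ofPred_eq, not_or, not_not] at hn
    exact hp (le_antisymm hn.1 hn.2)
  · exact hp (h.trans (h2 p h).symm)
  · exact hp ((h4 p h).trans h.symm)

end Heights

/-! ### The implication (1) ⇒ (3). -/

theorem completelyDecomposable_homogeneous_of_isPureInjectiveRel {Γ : Type v} {A : Γ → Type w}
    [∀ γ, AddCommGroup (A γ)] (hA : IsCompleteUniformFamily A) {N : Type u} [AddCommGroup N]
    [IsAddTorsionFree N] (hN : IsReducedGroup N)
    (hM : IsPureInjectiveRel (CountableMultiplesSum A) N) :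
    IsCompletelyDecomposable N ∧ IsHomogeneousGroup N ∧ Module.rank ℤ N < Cardinal.aleph0 := by
  have h1 := exists_retraction_pureSpan hA hM
  have hr := rank_lt_aleph0_of_exists_retraction hN (exists_retraction_pureClosure_range hA hM)
  refine ⟨isCompletelyDecomposable_of_exists_retraction h1 hr, fun a b ha hb => ?_, hr⟩
  obtain ⟨f, hf, hf'⟩ := exists_endomorphism_mem_pureSpan hN h1 ha hb
  obtain ⟨g, hg, hg'⟩ := exists_endomorphism_mem_pureSpan hN h1 hb ha
  exact elementType_eq_of_endomorphisms hf hf' hg hg'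

/-! ### Rank-one groups are classified by type. -/

section RankOne

variable {K : Type u} [AddCommGroup K]

/-- An element of finite `p`-height differs by a power of `p` from an element of `p`-height zero. -/
theorem exists_heightCharacteristic_eq_zero {a : K} (ha : a ≠ 0) {p : Nat.Primes}
    (hp : heightCharacteristic a p ≠ ⊤) :
    ∃ b : K, b ≠ 0 ∧ heightCharacteristic b p = 0 ∧
      ∀ q, q ≠ p → heightCharacteristic b q = heightCharacteristic a q := by
  obtain ⟨n, hn⟩ := ENat.ne_top_iff_exists.1 hp
  obtain ⟨b, hb⟩ := natCast_le_heightCharacteristic_iff.1 hn.le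
  refine ⟨b, ?_, ?_, fun q hq => le_antisymm ?_ ?_⟩
  · rintro rfl
    exact ha (by rw [← hb, smul_zero])
  · by_contra h0
    have h1 : ((1 : ℕ) : ℕ∞) ≤ heightCharacteristic b p := by
      simpa using Order.one_le_iff_ne_zero.2 h0
    obtain ⟨c, hc⟩ := natCast_le_heightCharacteristic_iff.1 h1
    have h2 : ((n + 1 : ℕ) : ℕ∞) ≤ heightCharacteristic a p :=
      natCast_le_heightCharacteristic_iff.2 ⟨c, by rw [pow_add, mul_smul, hc, hb]⟩
    rw [← hn] at h2
    have : n + 1 ≤ n := by exact_mod_cast h2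
    omega
  · refine ENat.le_of_forall_natCast_le fun k hk => ?_
    obtain ⟨c, hc⟩ := natCast_le_heightCharacteristic_iff.1 hk
    exact natCast_le_heightCharacteristic_iff.2 ⟨(p : ℕ) ^ n • c, by rw [smul_comm, hc, hb]⟩
  · refine ENat.le_of_forall_natCast_le fun k hk => ?_
    rw [natCast_le_heightCharacteristic_iff] at hk ⊢
    refine exists_nsmul_eq_of_isCoprime (m := ((p : ℕ) ^ n : ℕ)) ?_ (by simpa only [natCast_zsmul, hb])
    rw [Nat.isCoprime_iff_coprime]
    exact Nat.Coprime.pow _ _ ((Nat.coprime_primes q.2 p.2).2 fun h => hq (Subtype.ext h))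

variable {K' : Type v} [AddCommGroup K']

/-- Elements of the same type can be replaced by elements of the same characteristic. -/
theorem exists_heightCharacteristic_eq {a : K} {b : K'} (ha : a ≠ 0) (hb : b ≠ 0)
    (hab : CharacteristicEquiv (heightCharacteristic a) (heightCharacteristic b)) :
    ∃ (a' : K) (b' : K'), a' ≠ 0 ∧ b' ≠ 0 ∧ heightCharacteristic a' = heightCharacteristic b' := by
  obtain ⟨hfin, htop⟩ := hab
  obtain ⟨S, hS⟩ : ∃ S : Finset Nat.Primes,
      ∀ p ∉ S, heightCharacteristic a p = heightCharacteristic b p :=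
    ⟨hfin.toFinset, fun p hp => by simpa using hp⟩
  induction S using Finset.induction_on generalizing a b with
  | empty => exact ⟨a, b, ha, hb, funext fun p => hS p (by simp)⟩
  | insert p S _ ih =>
    by_cases hp : heightCharacteristic a p = heightCharacteristic b p
    · refine ih ha hb hfin htop fun q hq => ?_
      by_cases hqp : q = p
      · rw [hqp, hp]
      · exact hS q (by simp [hqp, hq])
    -- Both heights at `p` are reset to zero and the other primes are untouched, so `p` leaves the
    -- exceptional set.
    · obtain ⟨a₀, ha0, hap, haq⟩ := exists_heightCharacteristic_eq_zero ha (htop p hp).1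
      obtain ⟨b₀, hb0, hbp, hbq⟩ := exists_heightCharacteristic_eq_zero hb (htop p hp).2
      have hne : ∀ q, heightCharacteristic a₀ q ≠ heightCharacteristic b₀ q → q ≠ p := by
        rintro q hq rfl
        exact hq (hap.trans hbp.symm)
      refine ih ha0 hb0 (hfin.subset fun q hq => ?_) (fun q hq => ?_) fun q hq => ?_
      · have := hne q hq
        rwa [Set.mem_ofPred_eq, haq q this, hbq q this] at hq
      · have := hne q hq
        rw [haq q this, hbq q this] at hq ⊢
        exact htop q hq
      · by_contra h
        have := hne q h
        rw [haq q this, hbq q this] at h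
        exact h (hS q (by simp [this, hq]))

/-- Heights control prime-power divisors; Bézout combines coprime ones. -/
theorem exists_nsmul_eq_of_heightCharacteristic_le {a : K} {b : K'}
    (hab : heightCharacteristic a ≤ heightCharacteristic b) {k : ℕ} (hk : k ≠ 0)
    (h : ∃ x : K, k • x = a) : ∃ y : K', k • y = b := by
  induction k using Nat.recOnPosPrimePosCoprime with
  | prime_pow p n hp _ =>
    exact (natCast_le_heightCharacteristic_iff (p := ⟨p, hp⟩)).1
      (((natCast_le_heightCharacteristic_iff (p := ⟨p, hp⟩)).2 h).trans (hab _))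
  | zero => exact absurd rfl hk
  | one => exact ⟨b, one_smul _ _⟩
  | coprime m n _ _ hmn ihm ihn =>
    obtain ⟨hm, hn⟩ := mul_ne_zero_iff.1 hk
    obtain ⟨x, rfl⟩ := h
    obtain ⟨y, hy⟩ := ihm hm ⟨n • x, (mul_smul _ _ _).symm⟩
    obtain ⟨z, hz⟩ := ihn hn ⟨m • x, by rw [mul_comm, mul_smul]⟩
    obtain ⟨w, hw⟩ := exists_nsmul_eq_of_isCoprime (k := m) (m := n) (a := z)
      (Nat.isCoprime_iff_coprime.2 hmn) ⟨y, by rw [hy, natCast_zsmul, hz]⟩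
    exact ⟨w, by rw [mul_comm, mul_smul, hw, hz]⟩

/-- The image in `ℚ` thus depends only on the divisors of `a`, so equal characteristics give equal
images. -/
theorem mem_range_iff_of_injective_rat {a : K} {φ : K →+ ℚ} (hφ : Function.Injective φ)
    (ha : φ a = 1) {q : ℚ} : q ∈ φ.range ↔ ∃ x : K, q.den • x = a := by
  constructor
  · rintro ⟨x, hx⟩
    refine exists_nsmul_eq_of_isCoprime (m := q.num) ?_ ⟨x, hφ ?_⟩
    · rw [Int.isCoprime_iff_gcd_eq_one, Int.gcd, Int.natAbs_natCast]
      exact q.reduced.symm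
    · rw [map_nsmul, map_zsmul, hx, ha, nsmul_eq_mul, zsmul_eq_mul, mul_one, mul_comm,
        Rat.mul_den_eq_num]
  · rintro ⟨x, hx⟩
    refine ⟨q.num • x, ?_⟩
    have h1 : (q.den : ℚ) * φ x = 1 := by rw [← nsmul_eq_mul, ← map_nsmul, hx, ha]
    rw [map_zsmul, zsmul_eq_mul, ← Rat.mul_den_eq_num, mul_assoc, h1, mul_one]

/-- Torsion-free groups of rank one of the same type are isomorphic. -/
theorem nonempty_addEquiv_of_characteristicEquiv [IsAddTorsionFree K] [IsAddTorsionFree K']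
    (hK : ∀ a x : K, a ≠ 0 → x ∈ pureSpan a)
    (hK' : ∀ a x : K', a ≠ 0 → x ∈ pureSpan a) {a : K} {b : K'} (ha : a ≠ 0) (hb : b ≠ 0)
    (hab : CharacteristicEquiv (heightCharacteristic a) (heightCharacteristic b)) :
    Nonempty (K ≃+ K') := by
  obtain ⟨a, b, ha, hb, h⟩ := exists_heightCharacteristic_eq ha hb hab
  obtain ⟨φ, h1, hφ⟩ := exists_injective_hom_rat_of_forall_mem_pureSpan ha fun x => hK a x ha
  obtain ⟨ψ, h2, hψ⟩ := exists_injective_hom_rat_of_forall_mem_pureSpan hb fun x => hK' b x hb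
  have hr : φ.range = ψ.range := by
    ext q
    rw [mem_range_iff_of_injective_rat hφ h1, mem_range_iff_of_injective_rat hψ h2]
    exact ⟨exists_nsmul_eq_of_heightCharacteristic_le h.le q.den_nz,
      exists_nsmul_eq_of_heightCharacteristic_le h.ge q.den_nz⟩
  exact ⟨((AddMonoidHom.ofInjective hφ).trans (AddEquiv.addSubgroupCongr hr)).trans
    (AddMonoidHom.ofInjective hψ).symm⟩

theorem mem_pureSpan_of_equiv_rat_subgroup {H : AddSubgroup ℚ} (e : K ≃+ H) (a x : K)
    (ha : a ≠ 0) : x ∈ pureSpan a := by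
  obtain ⟨n, hn, m, h⟩ := Rat.exists_zsmul_eq_zsmul ((e x : H) : ℚ) (x := ((e a : H) : ℚ))
    (by simpa using ha)
  refine mem_pureSpan.2 ⟨n, hn, m, e.injective (Subtype.ext ?_)⟩
  simpa using h

end RankOne

/-! ### Pure-split groups and the implications (3) ⇒ (2) ⇒ (1). -/

section PureSplit

variable {N : Type u} [AddCommGroup N]

/-- Lets homogeneity of `N` compare the types of its rank-one summands. -/
theorem heightCharacteristic_coe [IsAddTorsionFree N] {K : AddSubgroup N} (hK : IsPureSubgroup K)
    (a : K) : heightCharacteristic (a : N) = heightCharacteristic a := by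
  funext p
  refine le_antisymm ?_ ?_ <;> refine ENat.le_of_forall_natCast_le fun k hk => ?_ <;>
    rw [natCast_le_heightCharacteristic_iff] at hk ⊢ <;> obtain ⟨b, hb⟩ := hk
  · have hpk : (((p : ℕ) ^ k : ℕ) : ℤ) ≠ 0 := by exact_mod_cast (pow_pos p.2.pos k).ne'
    have hbK : b ∈ K := isPureSubgroup_iff.1 hK _ hpk b (by rw [natCast_zsmul, hb]; exact a.2)
    exact ⟨⟨b, hbK⟩, Subtype.ext hb⟩
  · exact ⟨b, by rw [← hb]; rfl⟩

theorem isPureSubgroup_of_isInternal [IsAddTorsionFree N] {ι : Type*} [DecidableEq ι]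
    {K : ι → AddSubgroup N} (hK : DirectSum.IsInternal K) (i : ι) : IsPureSubgroup (K i) := by
  refine isPureSubgroup_iff.2 fun n hn x hx => ?_
  obtain ⟨y, rfl⟩ := hK.2 x
  have h1 : n • y = DirectSum.of (fun i => K i) i ⟨_, hx⟩ := by
    apply hK.1
    rw [map_zsmul, DirectSum.coeAddMonoidHom_of]
  have h2 : y = DirectSum.of (fun i => K i) i (y i) := by
    ext j
    by_cases hj : i = j
    · subst hj; rw [DirectSum.of_eq_same]
    · have h3 : n • y j = 0 := by
        have := DFunLike.congr_fun h1 j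
        rwa [DirectSum.of_eq_of_ne _ _ _ (Ne.symm hj)] at this
      rw [DirectSum.of_eq_of_ne _ _ _ (Ne.symm hj), (smul_eq_zero.1 h3).resolve_left hn]
  rw [h2, DirectSum.coeAddMonoidHom_of]
  exact (y i).2

theorem isCompl_ker_of_retraction {L : AddSubgroup N} {ρ : N →+ N} (h : ∀ x, ρ x ∈ L)
    (h' : ∀ x ∈ L, ρ x = x) : IsCompl L ρ.ker := by
  constructor
  · rw [AddSubgroup.disjoint_def]
    intro x hx hx'
    rw [← h' x hx]; exact hx'
  · rw [codisjoint_iff, AddSubgroup.eq_top_iff']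
    intro x
    refine AddSubgroup.mem_sup.2 ⟨ρ x, h x, x - ρ x, ?_, by abel⟩
    rw [AddMonoidHom.mem_ker, map_sub, h' _ (h x), sub_self]

theorem IsPureSplit.isPureInjectiveRel (h : IsPureSplit N) (K : Type v) [AddCommGroup K] :
    IsPureInjectiveRel K N := by
  intro L hL f
  obtain ⟨C, hC⟩ := h L hL
  have hC' : IsCompl (AddSubgroup.toIntSubmodule L) (AddSubgroup.toIntSubmodule C) :=
    AddSubgroup.toIntSubmodule.isCompl_iff.1 hC
  refine ⟨f.comp (Submodule.projectionOnto _ _ hC').toAddMonoidHom, fun x => ?_⟩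
  exact congrArg f (Submodule.projectionOnto_apply_left hC' x)

theorem IsPureSplit.of_equiv {N' : Type v} [AddCommGroup N'] [IsAddTorsionFree N']
    [IsAddTorsionFree N] (e : N ≃+ N') (h : IsPureSplit N) : IsPureSplit N' := by
  intro L hL
  obtain ⟨C, hC⟩ := h (e.mapAddSubgroup.symm L) (isPureSubgroup_iff.2 fun n hn x hx => by
    have hmem : ∀ y, y ∈ e.mapAddSubgroup.symm L ↔ e y ∈ L := fun y => AddSubgroup.mem_map_equiv
    rw [hmem, map_zsmul] at hx
    exact (hmem x).2 (isPureSubgroup_iff.1 hL n hn _ hx))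
  have h1 := e.mapAddSubgroup.isCompl hC
  rw [OrderIso.apply_symm_apply] at h1
  exact ⟨_, h1⟩

theorem exists_common_multiple {T : Type v} [AddCommGroup T] {t : T} (ht : ∀ x, x ∈ pureSpan t)
    {ι : Type*} [Fintype ι] (x : ι → T) :
    ∃ n : ℤ, n ≠ 0 ∧ ∃ z : ι → ℤ, ∀ i, n • x i = z i • t := by
  classical
  choose n hn m hm using fun i => mem_pureSpan.1 (ht (x i))
  refine ⟨∏ i, n i, Finset.prod_ne_zero_iff.2 fun i _ => hn i,
    fun i => (∏ j ∈ Finset.univ.erase i, n j) * m i, fun i => ?_⟩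
  rw [mul_smul, ← hm, smul_smul, Finset.prod_erase_mul _ _ (Finset.mem_univ i)]

/-- The pure subgroups of `ℤ^ι` are direct summands. -/
theorem exists_int_retraction {ι : Type*} [Fintype ι] (P : Submodule ℤ (ι → ℤ))
    (hP : ∀ n : ℤ, n ≠ 0 → ∀ z, n • z ∈ P → z ∈ P) :
    ∃ r : (ι → ℤ) →ₗ[ℤ] (ι → ℤ), (∀ z, r z ∈ P) ∧ ∀ z ∈ P, r z = z := by
  -- The quotient is finitely generated and torsion-free, hence projective, so `P.mkQ` has a
  -- section.
  have : Module.IsTorsionFree ℤ ((ι → ℤ) ⧸ P) := by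
    rw [Module.isTorsionFree_iff_smul_eq_zero]
    intro n q
    obtain ⟨z, rfl⟩ := P.mkQ_surjective q
    rw [← map_smul, Submodule.mkQ_apply, Submodule.mkQ_apply, Submodule.Quotient.mk_eq_zero,
      Submodule.Quotient.mk_eq_zero]
    exact fun h => or_iff_not_imp_left.2 fun hn => hP n hn z h
  obtain ⟨s, hs⟩ := Module.projective_lifting_property P.mkQ LinearMap.id P.mkQ_surjective
  refine ⟨LinearMap.id - s ∘ₗ P.mkQ, fun z => ?_, fun z hz => ?_⟩
  · rw [← Submodule.Quotient.mk_eq_zero, ← Submodule.mkQ_apply]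
    have := LinearMap.congr_fun hs (P.mkQ z)
    simp only [LinearMap.comp_apply, LinearMap.id_apply] at this
    simp only [LinearMap.sub_apply, LinearMap.comp_apply, LinearMap.id_apply, map_sub, this, sub_self]
  · have : P.mkQ z = 0 := by simpa using hz
    simp [this]

/-- A finite power of a torsion-free group of rank one is pure-split. -/
theorem isPureSplit_pi {T : Type v} [AddCommGroup T] [IsAddTorsionFree T] {t : T}
    (ht : ∀ x, x ∈ pureSpan t) (ι : Type*) [Fintype ι] : IsPureSplit (ι → T) := by
  classical
  intro L hL
  rw [isPureSubgroup_iff] at hL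
  let j : (ι → ℤ) →ₗ[ℤ] (ι → T) := LinearMap.pi fun i => (LinearMap.proj i).smulRight t
  have hj : ∀ z i, j z i = z i • t := fun _ _ => rfl
  obtain ⟨r, hr, hr'⟩ := exists_int_retraction ((AddSubgroup.toIntSubmodule L).comap j)
    fun n hn z hz => hL n hn (j z) (by rw [← map_zsmul]; exact hz)
  -- The integer matrix of `r` acting on `T`-vectors. Every vector has a nonzero multiple in the
  -- image of `j`, so its properties can be checked on that image.
  let ρ : (ι → T) →+ (ι → T) :=
    { toFun := fun x i => ∑ k, r (Pi.single k 1) i • x k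
      map_zero' := by ext; simp
      map_add' := fun x y => by ext; simp [Finset.sum_add_distrib] }
  have hρ : ∀ z, ρ (j z) = j (r z) := by
    intro z
    ext i
    have hz : r z = ∑ k, z k • r (Pi.single k 1) := by
      conv_lhs => rw [← Finset.univ_sum_single z, map_sum]
      refine Finset.sum_congr rfl fun k _ => ?_
      rw [← map_smul]
      congr 1
      ext l
      simp [Pi.single_apply]
    show ∑ k, r (Pi.single k 1) i • j z k = j (r z) i
    rw [hj, hz, Finset.sum_apply, Finset.sum_smul]
    refine Finset.sum_congr rfl fun k _ => ?_
    rw [hj, smul_smul, Pi.smul_apply, smul_eq_mul, mul_comm]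
  have hden : ∀ x : ι → T, ∃ n : ℤ, n ≠ 0 ∧ ∃ z, n • x = j z := fun x => by
    obtain ⟨n, hn, z, hz⟩ := exists_common_multiple ht x
    exact ⟨n, hn, z, funext hz⟩
  refine ⟨ρ.ker, isCompl_ker_of_retraction (fun x => ?_) fun x hx => ?_⟩
  · obtain ⟨n, hn, z, hz⟩ := hden x
    refine hL n hn _ ?_
    rw [← map_zsmul, hz, hρ]
    exact hr z
  · obtain ⟨n, hn, z, hz⟩ := hden x
    refine smul_right_injective _ hn ?_
    show n • ρ x = n • x
    rw [← map_zsmul, hz, hρ, hr' z]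
    show j z ∈ L
    rw [← hz]
    exact zsmul_mem hx n

theorem finite_of_isInternal_of_rank_lt_aleph0 [IsAddTorsionFree N] {ι : Type u} [DecidableEq ι]
    {K : ι → AddSubgroup N} (hK : DirectSum.IsInternal K) (hne : ∀ i, K i ≠ ⊥)
    (hr : Module.rank ℤ N < Cardinal.aleph0) : Finite ι := by
  have hK' : DirectSum.IsInternal fun i => AddSubgroup.toIntSubmodule (K i) := hK
  choose a ha using fun i => AddSubgroup.ne_bot_iff_exists_ne_zero.1 (hne i)
  have := iSupIndep.linearIndependent _ hK'.submodule_iSupIndep (v := fun i => (a i : N))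
    (fun i => (a i).2) fun i => by simpa using ha i
  exact Cardinal.lt_aleph0_iff_finite.1 (this.cardinal_le_rank.trans_lt hr)

/-- Completely decomposable homogeneous groups of finite rank are pure-split. -/
theorem IsCompletelyDecomposable.isPureSplit [IsAddTorsionFree N] (h : IsCompletelyDecomposable N)
    (hh : IsHomogeneousGroup N) (hr : Module.rank ℤ N < Cardinal.aleph0) : IsPureSplit N := by
  obtain ⟨ι, _, K, hK, hH⟩ := h
  have hnt : ∀ i, Nontrivial (K i) := fun i => by
    obtain ⟨H, hH, ⟨e⟩⟩ := hH i
    have := H.bot_or_nontrivial.resolve_left hH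
    exact e.toEquiv.nontrivial
  have hfin : Finite ι := finite_of_isInternal_of_rank_lt_aleph0 hK
    (fun i => (K i).nontrivial_iff_ne_bot.1 (hnt i)) hr
  have := Fintype.ofFinite ι
  let e₁ : (∀ i, K i) ≃+ N := (DirectSum.addEquivProd fun i => K i).symm.trans
    (AddEquiv.ofBijective _ hK)
  rcases isEmpty_or_nonempty ι with hι | ⟨⟨i₀⟩⟩
  -- With no summands there is no model `K i₀`, but then `N = 0`.
  · have : Subsingleton N := e₁.symm.toEquiv.subsingleton
    intro L _
    exact ⟨⊤, by rw [Subsingleton.elim L ⊥]; exact isCompl_bot_top⟩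
  have hrk : ∀ i, ∀ a x : K i, a ≠ 0 → x ∈ pureSpan a := fun i => by
    obtain ⟨H, hH, ⟨e⟩⟩ := hH i
    exact mem_pureSpan_of_equiv_rat_subgroup e
  have hpure := isPureSubgroup_of_isInternal hK
  obtain ⟨t, ht⟩ := exists_ne (0 : K i₀)
  have hiso : ∀ i, Nonempty (K i₀ ≃+ K i) := fun i => by
    obtain ⟨b, hb⟩ := exists_ne (0 : K i)
    refine nonempty_addEquiv_of_characteristicEquiv (hrk i₀) (hrk i) ht hb ?_
    have := Quotient.exact (hh (t : N) b (by simpa using ht) (by simpa using hb))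
    rwa [heightCharacteristic_coe (hpure _), heightCharacteristic_coe (hpure _)] at this
  let e₂ : (ι → K i₀) ≃+ N := (AddEquiv.piCongrRight fun i => (hiso i).some).trans e₁
  exact (isPureSplit_pi (fun x => hrk i₀ t x ht) ι).of_equiv e₂

end PureSplit

theorem mainTheorem8 {Γ : Type v} (A : Γ → Type w) [∀ γ, AddCommGroup (A γ)]
    (hA : IsCompleteUniformFamily A)
    (N : Type u) [AddCommGroup N] [IsAddTorsionFree N] (hN : IsReducedGroup N) :
    List.TFAE
      [IsPureInjectiveRel (CountableMultiplesSum A) N,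
       IsPureSplit N,
       IsCompletelyDecomposable N ∧ IsHomogeneousGroup N ∧
         Module.rank ℤ N < Cardinal.aleph0] := by
  tfae_have 1 → 3 := completelyDecomposable_homogeneous_of_isPureInjectiveRel hA hN
  tfae_have 3 → 2 := fun h => h.1.isPureSplit h.2.1 h.2.2
  tfae_have 2 → 1 := fun h => h.isPureInjectiveRel _
  tfae_finish
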